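/- Let $n\ge 3$. Let $\mathfrak{h}_n=\mathbb{C}^{2n}\oplus\mathbb{C}z$ be the Heisenberg Lie algebra: if $e_1,\dots,e_{2n}$ is the standard basis of $\mathbb{C}^{2n}$, its bracket is given by $[e_i,e_{n+i}]=-[e_{n+i},e_i]=z$ for $1\le i\le n$, all other brackets of basis elements being zero. Let $\mathfrak{sl}_2\oplus\mathfrak{so}_n$ be the direct sum of the complex Lie algebras of $2\times 2$ matrices of trace zero and of skew-symmetric $n\times n$ matrices. It acts on $\mathfrak{h}_n$ by derivations, by matrix multiplication on $\mathbb{C}^{2n}$ and by zero on $z$, where $$\begin{pmatrix} a & b\\ c & -a\end{pmatrix}\in\mathfrak{sl}_2\ \text{ acts on } \mathbb{C}^{2n} \text{ as } \begin{pmatrix} aI_n & bI_n\\ cI_n & -aI_n\end{pmatrix}, \qquad A\in\mathfrak{so}_n\ \text{ acts as } \begin{pmatrix} A & 0\\ 0 & A\end{pmatrix}.$$ Let $\mathfrak{s}_n=(\mathfrak{sl}_2\oplus\mathfrak{so}_n)\ltimes\mathfrak{h}_n$ be the corresponding semidirect product, the complex Schrödinger algebra in $(n+1)$-dimensional space-time.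 A derivation of a Lie algebra $\mathcal{L}$ is a linear map $D:\mathcal{L}\to\mathcal{L}$ with $D([x,y])=[D(x),y]+[x,D(y)]$ for all $x,y\in\mathcal{L}$. A linear map $\Delta:\mathcal{L}\to\mathcal{L}$ is called a local derivation if for every $x\in\mathcal{L}$ there is a derivation $D_x$ of $\mathcal{L}$, possibly depending on $x$, such that $\Delta(x)=D_x(x)$. Then every local derivation on $\mathfrak{s}_n$ is a derivation. -/

import Mathlib

namespace Schrodinger

open Matrix

attribute [local instance] LieRing.ofAssociativeRing

/-- The underlying space `ℂ^{2n} ⊕ ℂ z` of the Heisenberg Lie algebra `h_n`. The standard basis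
`e_1, …, e_n, e_{n+1}, …, e_{2n}` of `ℂ^{2n}` is indexed by `Fin n ⊕ Fin n`: the left summand
indexes `u_i = e_i`, the right summand indexes `v_i = e_{n+i}`. -/
@[ext]
structure Heisenberg (n : ℕ) where
  /-- the component in `ℂ^{2n}` -/
  vec : Fin n ⊕ Fin n → ℂ
  /-- the coefficient of the central element `z` -/
  central : ℂ

namespace Heisenberg

variable {n : ℕ}

/-- As a set, the Heisenberg algebra is a product. -/
def toProd : Heisenberg n ≃ (Fin n ⊕ Fin n → ℂ) × ℂ where
  toFun x := (x.vec, x.central)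
  invFun p := ⟨p.1, p.2⟩
  left_inv _ := rfl
  right_inv _ := rfl

instance : AddCommGroup (Heisenberg n) := toProd.addCommGroup

noncomputable instance : Module ℂ (Heisenberg n) := toProd.module ℂ

@[simp] lemma vec_zero : (0 : Heisenberg n).vec = 0 := rfl
@[simp] lemma central_zero : (0 : Heisenberg n).central = 0 := rfl
@[simp] lemma vec_add (x y : Heisenberg n) : (x + y).vec = x.vec + y.vec := rfl
@[simp] lemma central_add (x y : Heisenberg n) :
    (x + y).central = x.central + y.central := rfl
@[simp] lemma vec_sub (x y : Heisenberg n) : (x - y).vec = x.vec - y.vec := rfl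
@[simp] lemma central_sub (x y : Heisenberg n) :
    (x - y).central = x.central - y.central := rfl
@[simp] lemma vec_neg (x : Heisenberg n) : (-x).vec = -x.vec := rfl
@[simp] lemma central_neg (x : Heisenberg n) : (-x).central = -x.central := rfl
@[simp] lemma vec_smul (c : ℂ) (x : Heisenberg n) : (c • x).vec = c • x.vec := rfl
@[simp] lemma central_smul (c : ℂ) (x : Heisenberg n) :
    (c • x).central = c * x.central := rfl

/-- The bracket is determined by `[u_i, v_i] = z`, all other brackets of basis elements being
zero (up to antisymmetry). -/
noncomputable instance : Bracket (Heisenberg n) (Heisenberg n) where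
  bracket x y :=
    ⟨0, ∑ i, (x.vec (Sum.inl i) * y.vec (Sum.inr i) - x.vec (Sum.inr i) * y.vec (Sum.inl i))⟩

@[simp] lemma vec_lie (x y : Heisenberg n) : ⁅x, y⁆.vec = 0 := rfl
@[simp] lemma central_lie (x y : Heisenberg n) : ⁅x, y⁆.central =
    ∑ i, (x.vec (Sum.inl i) * y.vec (Sum.inr i) - x.vec (Sum.inr i) * y.vec (Sum.inl i)) := rfl

noncomputable instance : LieRing (Heisenberg n) where
  add_lie x y w := by
    ext1
    · simp
    · simp only [central_lie, central_add, vec_add, Pi.add_apply, ← Finset.sum_add_distrib]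
      exact Finset.sum_congr rfl fun _ _ => by ring
  lie_add x y w := by
    ext1
    · simp
    · simp only [central_lie, central_add, vec_add, Pi.add_apply, ← Finset.sum_add_distrib]
      exact Finset.sum_congr rfl fun _ _ => by ring
  lie_self x := by
    ext1
    · simp
    · simp only [central_lie, central_zero]
      exact Finset.sum_eq_zero fun _ _ => by ring
  leibniz_lie x y w := by
    ext1 <;> simp

noncomputable instance : LieAlgebra ℂ (Heisenberg n) where
  lie_smul c x y := by
    ext1
    · simp
    · simp only [central_lie, central_smul, vec_smul, Pi.smul_apply, smul_eq_mul,
        Finset.mul_sum]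
      exact Finset.sum_congr rfl fun _ _ => by ring

end Heisenberg

/-- The semisimple Lie algebra `sl_2 ⊕ so_n` over `ℂ`. -/
abbrev Levi (n : ℕ) : Type :=
  LieAlgebra.SpecialLinear.sl (Fin 2) ℂ × LieAlgebra.Orthogonal.so (Fin n) ℂ

/-- The matrix in `gl_{2n}` of an element of `sl_2 ⊕ so_n`: the matrix `(a b; c d)` of `sl_2`
(so `d = -a`) goes to `(a I b I; c I d I)`, and `A ∈ so_n` goes to `(A 0; 0 A)`. -/
noncomputable def Levi.toMatrix {n : ℕ} (g : Levi n) : Matrix (Fin n ⊕ Fin n) (Fin n ⊕ Fin n) ℂ :=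
  fromBlocks (g.1.1 0 0 • (1 : Matrix (Fin n) (Fin n) ℂ)) (g.1.1 0 1 • 1)
    (g.1.1 1 0 • 1) (g.1.1 1 1 • 1) +
  fromBlocks g.2.1 0 0 g.2.1

lemma Levi.toMatrix_add {n : ℕ} (g g' : Levi n) :
    (g + g').toMatrix = g.toMatrix + g'.toMatrix := by
  have h1 : (g + g').1.1 = g.1.1 + g'.1.1 := rfl
  have h2 : (g + g').2.1 = g.2.1 + g'.2.1 := rfl
  simp only [Levi.toMatrix, h1, h2, Matrix.add_apply, fromBlocks_add, add_smul, add_zero]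
  congr 1 <;> abel

lemma Levi.toMatrix_smul {n : ℕ} (c : ℂ) (g : Levi n) :
    (c • g).toMatrix = c • g.toMatrix := by
  have h1 : (c • g).1.1 = c • g.1.1 := rfl
  have h2 : (c • g).2.1 = c • g.2.1 := rfl
  simp only [Levi.toMatrix, h1, h2, Matrix.smul_apply, fromBlocks_add, fromBlocks_smul, smul_add,
    smul_smul, smul_eq_mul, add_zero]

lemma Levi.toMatrix_lie {n : ℕ} (g g' : Levi n) :
    ⁅g, g'⁆.toMatrix = g.toMatrix * g'.toMatrix - g'.toMatrix * g.toMatrix := by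
  have h1 : ⁅g, g'⁆.1.1 = g.1.1 * g'.1.1 - g'.1.1 * g.1.1 := rfl
  have h2 : ⁅g, g'⁆.2.1 = g.2.1 * g'.2.1 - g'.2.1 * g.2.1 := rfl
  simp only [Levi.toMatrix, h1, h2, Matrix.sub_apply, Matrix.mul_apply, Fin.sum_univ_two,
    fromBlocks_add, fromBlocks_multiply, sub_eq_add_neg, fromBlocks_neg, add_zero]
  congr 1 <;>
  · simp only [mul_add, add_mul, Matrix.smul_mul, Matrix.mul_smul, Matrix.one_mul,
      Matrix.mul_one, smul_smul]
    module

lemma Levi.toMatrix_mulVec_inl {n : ℕ} (g : Levi n) (x : Fin n ⊕ Fin n → ℂ) (i : Fin n) :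
    (g.toMatrix *ᵥ x) (Sum.inl i) = g.1.1 0 0 * x (Sum.inl i) + g.1.1 0 1 * x (Sum.inr i)
      + ∑ j, g.2.1 i j * x (Sum.inl j) := by
  simp [Levi.toMatrix, mulVec, dotProduct, Matrix.one_apply, add_mul, Finset.sum_add_distrib]

lemma Levi.toMatrix_mulVec_inr {n : ℕ} (g : Levi n) (x : Fin n ⊕ Fin n → ℂ) (i : Fin n) :
    (g.toMatrix *ᵥ x) (Sum.inr i) = g.1.1 1 0 * x (Sum.inl i) + g.1.1 1 1 * x (Sum.inr i)
      + ∑ j, g.2.1 i j * x (Sum.inr j) := by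
  simp [Levi.toMatrix, mulVec, dotProduct, Matrix.one_apply, add_mul, Finset.sum_add_distrib]

/-- The elements of `sl_2 ⊕ so_n` preserve the symplectic form on `ℂ^{2n}`. -/
lemma Levi.invariant {n : ℕ} (g : Levi n) (x y : Fin n ⊕ Fin n → ℂ) :
    ∑ i, ((g.toMatrix *ᵥ x) (Sum.inl i) * y (Sum.inr i)
        - (g.toMatrix *ᵥ x) (Sum.inr i) * y (Sum.inl i))
      + ∑ i, (x (Sum.inl i) * (g.toMatrix *ᵥ y) (Sum.inr i)
        - x (Sum.inr i) * (g.toMatrix *ᵥ y) (Sum.inl i)) = 0 := by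
  have htr : g.1.1 1 1 = -g.1.1 0 0 := by
    have h : Matrix.trace g.1.1 = 0 := g.1.2
    rw [Matrix.trace_fin_two] at h
    linear_combination h
  have hso : ∀ i j, g.2.1 j i = -g.2.1 i j := fun i j =>
    congrFun (congrFun ((LieAlgebra.Orthogonal.mem_so (Fin n) ℂ g.2.1).1 g.2.2) i) j
  have key : ∀ p q : Fin n → ℂ,
      ∑ i, (∑ j, g.2.1 i j * p j) * q i + ∑ i, p i * ∑ j, g.2.1 i j * q j = 0 := by
    intro p q
    simp only [Finset.sum_mul, Finset.mul_sum]
    rw [Finset.sum_comm, ← Finset.sum_add_distrib]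
    refine Finset.sum_eq_zero fun i _ => ?_
    rw [← Finset.sum_add_distrib]
    refine Finset.sum_eq_zero fun j _ => ?_
    rw [hso i j]
    ring
  have h1 := key (fun i => x (Sum.inl i)) (fun i => y (Sum.inr i))
  have h2 := key (fun i => x (Sum.inr i)) (fun i => y (Sum.inl i))
  rw [← sub_eq_zero.2 (h1.trans h2.symm)]
  simp only [Levi.toMatrix_mulVec_inl, Levi.toMatrix_mulVec_inr, htr]
  simp only [← Finset.sum_add_distrib, ← Finset.sum_sub_distrib]
  exact Finset.sum_congr rfl fun _ _ => by ring

/-- An element of `sl_2 ⊕ so_n` acts on `h_n = ℂ^{2n} ⊕ ℂ z` by matrix multiplication on `ℂ^{2n}`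
and by zero on `z`; this is a derivation of `h_n`. -/
noncomputable def actDer {n : ℕ} (g : Levi n) :
    LieDerivation ℂ (Heisenberg n) (Heisenberg n) where
  toFun x := ⟨g.toMatrix *ᵥ x.vec, 0⟩
  map_add' x y := by ext1 <;> simp [mulVec_add]
  map_smul' c x := by ext1 <;> simp [mulVec_smul]
  leibniz' x y := by
    ext1
    · simp
    · have h := Levi.invariant g x.vec y.vec
      simp only [LinearMap.coe_mk, AddHom.coe_mk, Heisenberg.central_sub, Heisenberg.central_lie]
      rw [← h, add_comm, sub_eq_add_neg, ← Finset.sum_neg_distrib]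
      congr 1
      exact Finset.sum_congr rfl fun _ _ => by ring

/-- The action of `sl_2 ⊕ so_n` on `h_n` by derivations. -/
noncomputable def act (n : ℕ) : Levi n →ₗ⁅ℂ⁆ LieDerivation ℂ (Heisenberg n) (Heisenberg n) where
  toFun := actDer
  map_add' g g' := by
    ext x : 2 <;> simp [actDer, Levi.toMatrix_add, add_mulVec]
  map_smul' c g := by
    ext x : 2 <;> simp [actDer, Levi.toMatrix_smul, smul_mulVec]
  map_lie' {g g'} := by
    ext x : 2
    · rw [LieDerivation.commutator_apply]
      change ⁅g, g'⁆.toMatrix *ᵥ x.vec =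
        g.toMatrix *ᵥ (g'.toMatrix *ᵥ x.vec) - g'.toMatrix *ᵥ (g.toMatrix *ᵥ x.vec)
      rw [Levi.toMatrix_lie, sub_mulVec, mulVec_mulVec, mulVec_mulVec]
    · simp [actDer]

/-- The complex Schrödinger algebra `s_n = (sl_2 ⊕ so_n) ⋉ h_n` in `(n+1)`-dimensional
space-time. -/
abbrev SchrodingerAlgebra (n : ℕ) : Type :=
  LieAlgebra.SemiDirectSum (Heisenberg n) (Levi n) (act n)

end Schrodinger

/-- A linear operator `Δ` on a Lie algebra `L` is a local derivation if for each `x` there is a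
derivation `D` of `L`, possibly depending on `x`, with `Δ x = D x`. -/
def IsLocalDerivation {R L : Type*} [CommRing R] [LieRing L] [LieAlgebra R L]
    (Δ : L →ₗ[R] L) : Prop :=
  ∀ x : L, ∃ D : LieDerivation R L L, Δ x = D x

/-!
Write `G` for the matrix on `V = ℂ^{2n}` of `g ∈ sl_2 ⊕ so_n` and `ω` for the symplectic form on
`V`, so that `[v, w] = ω v w z`.

A derivation `D` of the Schrödinger algebra has the form
`D (g + v + t z) = [ρ, g] + (ρ v + c v - G v₀) + (ω v₀ v + 2 c t) z`
with `v₀ ∈ V`, a scalar `c` and an infinitesimal symplectic transformation `ρ` of `V`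
(`exists_form_of_lieDerivation`). For this one uses that the centre is `ℂ z`, that `diag(1, -1)` has
different eigenvalues on `V` and on `sl_2 ⊕ so_n`, and, for the vanishing of the central component
of `D g`, that `sl_2 ⊕ so_n` is perfect when `n ≥ 3`. The finer fact that `ρ` comes from
`sl_2 ⊕ so_n` is not needed.

Evaluated at the conjugate `x = g + G w + t z`, `t = ω (G w) w / 2`, of `g` under the Heisenberg
group, every derivation satisfies an identity between the components of `D x` in which `ρ`, `v₀` and
`c` do not occur (`IsLocalDerivation.symplecticForm_vecPart`), so a local derivation `Δ` satisfies
it too. The identity is polynomial in `w`. Write `A g` and `B g` for the components of `Δ g` in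
`sl_2 ⊕ so_n` and `V`, and let `Δ v = P v + ω v₁ v z`, `Δ z = μ z`. The part linear in `w` says that
`B g = -G v₁`. The quadratic part says that `Q = P - μ / 2` satisfies
`ω (Q (G w)) w = ω (A(g) w) w / 2`. For `g ∈ sl_2` the element `A g` lies in `sl_2`, and for
`h = diag(1, -1)` its diagonal is zero, because the two diagonal `n × n` blocks of a commutator
`[ρ, g]` have sum zero, and are themselves zero if `g = h`. Comparing `n × n` blocks for the three standard basis elements of `sl_2` then
yields that `Q` is the matrix of some `g₁ ∈ sl_2 ⊕ so_n` (`exists_levi_toMatrix_eq`), after which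
the quadratic identity gives `A g = [g₁, g]` for all `g`. Hence `Δ` is the inner derivation of
`g₁ + v₁` plus `μ / 2` times the grading derivation.
-/

namespace Schrodinger

open Matrix LieAlgebra

variable {n : ℕ}

/-! ### The symplectic form and the matrices of the Levi factor -/

/-- The symplectic form on `ℂ^{2n}` that gives the bracket of the Heisenberg algebra. -/
noncomputable def symplecticForm (n : ℕ) :
    (Fin n ⊕ Fin n → ℂ) →ₗ[ℂ] (Fin n ⊕ Fin n → ℂ) →ₗ[ℂ] ℂ :=
  LinearMap.mk₂ ℂ
    (fun v w => ∑ i, (v (Sum.inl i) * w (Sum.inr i) - v (Sum.inr i) * w (Sum.inl i)))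
    (fun v v' w => by
      simp only [Pi.add_apply, ← Finset.sum_add_distrib]
      exact Finset.sum_congr rfl fun _ _ => by ring)
    (fun c v w => by
      simp only [Pi.smul_apply, smul_eq_mul, Finset.mul_sum]
      exact Finset.sum_congr rfl fun _ _ => by ring)
    (fun v w w' => by
      simp only [Pi.add_apply, ← Finset.sum_add_distrib]
      exact Finset.sum_congr rfl fun _ _ => by ring)
    (fun c v w => by
      simp only [Pi.smul_apply, smul_eq_mul, Finset.mul_sum]
      exact Finset.sum_congr rfl fun _ _ => by ring)

local notation "ω" => symplecticForm _

lemma symplecticForm_apply (v w : Fin n ⊕ Fin n → ℂ) :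
    ω v w = ∑ i, (v (Sum.inl i) * w (Sum.inr i) - v (Sum.inr i) * w (Sum.inl i)) := rfl

lemma symplecticForm_swap (v w : Fin n ⊕ Fin n → ℂ) : ω v w = -ω w v := by
  rw [symplecticForm_apply, symplecticForm_apply, ← Finset.sum_neg_distrib]
  exact Finset.sum_congr rfl fun _ _ => by ring

lemma symplecticForm_single_inl (v : Fin n ⊕ Fin n → ℂ) (i : Fin n) :
    ω v (Pi.single (Sum.inl i) 1) = -v (Sum.inr i) := by
  simp [symplecticForm_apply, Pi.single_apply]

lemma symplecticForm_single_inr (v : Fin n ⊕ Fin n → ℂ) (i : Fin n) :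
    ω v (Pi.single (Sum.inr i) 1) = v (Sum.inl i) := by
  simp [symplecticForm_apply, Pi.single_apply]

lemma eq_of_symplecticForm_eq {v v' : Fin n ⊕ Fin n → ℂ} (h : ∀ w, ω v w = ω v' w) : v = v' := by
  ext (i | i)
  · simpa only [symplecticForm_single_inr] using h (Pi.single (Sum.inr i) 1)
  · simpa only [symplecticForm_single_inl, neg_inj] using h (Pi.single (Sum.inl i) 1)

/-- The symplectic form is nondegenerate, so it represents every linear functional. -/
lemma exists_symplecticForm_eq (φ : (Fin n ⊕ Fin n → ℂ) →ₗ[ℂ] ℂ) : ∃ v, ∀ w, φ w = ω v w := by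
  let v : Fin n ⊕ Fin n → ℂ :=
    Sum.elim (fun i => φ (Pi.single (Sum.inr i) 1)) (fun i => -φ (Pi.single (Sum.inl i) 1))
  have h : φ = ω v := by
    refine LinearMap.pi_ext' fun i => LinearMap.ext_ring ?_
    rcases i with i | i
    · simp [symplecticForm_single_inl, v]
    · simp [symplecticForm_single_inr, v]
  exact ⟨v, fun w => by rw [h]⟩

lemma symplecticForm_toMatrix (g : Levi n) (v w : Fin n ⊕ Fin n → ℂ) :
    ω (g.toMatrix *ᵥ v) w = -ω v (g.toMatrix *ᵥ w) :=
  eq_neg_of_add_eq_zero_left (Levi.invariant g v w)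

lemma Levi.apply_one_one (g : Levi n) : g.1.1 1 1 = -g.1.1 0 0 := by
  have h : Matrix.trace g.1.1 = 0 := g.1.2
  rw [Matrix.trace_fin_two] at h
  linear_combination h

lemma Levi.apply_swap (g : Levi n) (i j : Fin n) : g.2.1 j i = -g.2.1 i j :=
  congrFun (congrFun ((LieAlgebra.Orthogonal.mem_so (Fin n) ℂ g.2.1).1 g.2.2) i) j

lemma Levi.apply_self (g : Levi n) (i : Fin n) : g.2.1 i i = 0 :=
  self_eq_neg.1 (g.apply_swap i i)

lemma Levi.toMatrix_inl_inl (g : Levi n) (i j : Fin n) :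
    g.toMatrix (Sum.inl i) (Sum.inl j) = g.1.1 0 0 * (1 : Matrix (Fin n) (Fin n) ℂ) i j
      + g.2.1 i j := by
  simp [Levi.toMatrix]

lemma Levi.toMatrix_inl_inr (g : Levi n) (i j : Fin n) :
    g.toMatrix (Sum.inl i) (Sum.inr j) = g.1.1 0 1 * (1 : Matrix (Fin n) (Fin n) ℂ) i j := by
  simp [Levi.toMatrix]

lemma Levi.toMatrix_inr_inl (g : Levi n) (i j : Fin n) :
    g.toMatrix (Sum.inr i) (Sum.inl j) = g.1.1 1 0 * (1 : Matrix (Fin n) (Fin n) ℂ) i j := by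
  simp [Levi.toMatrix]

lemma Levi.toMatrix_inr_inr (g : Levi n) (i j : Fin n) :
    g.toMatrix (Sum.inr i) (Sum.inr j) = -g.1.1 0 0 * (1 : Matrix (Fin n) (Fin n) ℂ) i j
      + g.2.1 i j := by
  simp [Levi.toMatrix, Levi.apply_one_one]

lemma Levi.ext_entries {g g' : Levi n} (h00 : g.1.1 0 0 = g'.1.1 0 0)
    (h01 : g.1.1 0 1 = g'.1.1 0 1) (h10 : g.1.1 1 0 = g'.1.1 1 0) (h2 : g.2.1 = g'.2.1) :
    g = g' := by
  refine Prod.ext (Subtype.ext ?_) (Subtype.ext h2)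
  ext i j
  fin_cases i <;> fin_cases j
  · exact h00
  · exact h01
  · exact h10
  · exact (g.apply_one_one.trans (by rw [h00])).trans g'.apply_one_one.symm

/-- The action of `sl_2 ⊕ so_n` on `ℂ^{2n}` is faithful. -/
lemma Levi.toMatrix_injective (hn : 0 < n) : Function.Injective (Levi.toMatrix (n := n)) := by
  intro g g' h
  have e := fun x y => congrFun (congrFun h x) y
  let k : Fin n := ⟨0, hn⟩
  have h00 : g.1.1 0 0 = g'.1.1 0 0 := by
    simpa [Levi.toMatrix_inl_inl, Levi.apply_self] using e (Sum.inl k) (Sum.inl k)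
  refine Levi.ext_entries h00 ?_ ?_ ?_
  · simpa [Levi.toMatrix_inl_inr] using e (Sum.inl k) (Sum.inr k)
  · simpa [Levi.toMatrix_inr_inl] using e (Sum.inr k) (Sum.inl k)
  · ext i j
    simpa [Levi.toMatrix_inl_inl, h00] using e (Sum.inl i) (Sum.inl j)

/-- Polarization of a vanishing quadratic form `w ↦ ω (M w) w`. -/
lemma symplecticForm_polar {M : Matrix (Fin n ⊕ Fin n) (Fin n ⊕ Fin n) ℂ}
    (h : ∀ w, ω (M *ᵥ w) w = 0) (v w : Fin n ⊕ Fin n → ℂ) :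
    ω (M *ᵥ v) w + ω (M *ᵥ w) v = 0 := by
  have h1 := h (v + w)
  simp only [mulVec_add, map_add, LinearMap.add_apply, h v, h w] at h1
  linear_combination h1

/-- If `M w` is symplectically orthogonal to `w` for all `w`, then `M` equals its own symplectic
adjoint; this is that identity in terms of matrix entries. -/
lemma entries_of_symplecticForm_self_eq_zero {M : Matrix (Fin n ⊕ Fin n) (Fin n ⊕ Fin n) ℂ}
    (h : ∀ w, ω (M *ᵥ w) w = 0) (i j : Fin n) :
    M (Sum.inl j) (Sum.inl i) = M (Sum.inr i) (Sum.inr j) ∧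
      M (Sum.inl j) (Sum.inr i) = -M (Sum.inl i) (Sum.inr j) := by
  have h1 := symplecticForm_polar h (Pi.single (Sum.inl i) 1) (Pi.single (Sum.inr j) 1)
  have h2 := symplecticForm_polar h (Pi.single (Sum.inr i) 1) (Pi.single (Sum.inr j) 1)
  simp only [symplecticForm_single_inl, symplecticForm_single_inr, mulVec_single_one,
    col_apply] at h1 h2
  exact ⟨by linear_combination h1, by linear_combination h2⟩

/-- An element of `sl_2 ⊕ so_n` is determined by its Hamiltonian, the quadratic form
`w ↦ ω (G w) w`. -/
lemma Levi.eq_of_symplecticForm_self_eq (hn : 0 < n) {g g' : Levi n}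
    (h : ∀ w, ω (g.toMatrix *ᵥ w) w = ω (g'.toMatrix *ᵥ w) w) : g = g' := by
  refine Levi.toMatrix_injective hn (Matrix.ext_of_mulVec_single fun i => ?_)
  refine eq_of_symplecticForm_eq fun w => ?_
  have h1 := symplecticForm_polar (M := g.toMatrix - g'.toMatrix)
    (fun w => by rw [sub_mulVec, map_sub, LinearMap.sub_apply, h, sub_self]) (Pi.single i 1) w
  simp only [sub_mulVec, map_sub, LinearMap.sub_apply] at h1
  rw [symplecticForm_toMatrix g w, symplecticForm_toMatrix g' w, symplecticForm_swap w,
    symplecticForm_swap w] at h1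
  linear_combination 2⁻¹ * h1

/-! ### Elements and brackets of the Schrödinger algebra -/

/-- The element `g + v + t z` of the Schrödinger algebra. -/
def elt (g : Levi n) (v : Fin n ⊕ Fin n → ℂ) (t : ℂ) : SchrodingerAlgebra n := ⟨⟨v, t⟩, g⟩

/-- The projection of the Schrödinger algebra onto `sl_2 ⊕ so_n`. -/
def leviPart (n : ℕ) : SchrodingerAlgebra n →ₗ[ℂ] Levi n where
  toFun x := x.right
  map_add' _ _ := rfl
  map_smul' _ _ := rfl

/-- The projection of the Schrödinger algebra onto `ℂ^{2n}`. -/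
def vecPart (n : ℕ) : SchrodingerAlgebra n →ₗ[ℂ] (Fin n ⊕ Fin n → ℂ) where
  toFun x := x.left.vec
  map_add' _ _ := rfl
  map_smul' _ _ := rfl

/-- The coefficient of the central element `z`. -/
def centralPart (n : ℕ) : SchrodingerAlgebra n →ₗ[ℂ] ℂ where
  toFun x := x.left.central
  map_add' _ _ := rfl
  map_smul' _ _ := rfl

/-- The inclusion of `sl_2 ⊕ so_n`. -/
def ofLevi (n : ℕ) : Levi n →ₗ[ℂ] SchrodingerAlgebra n where
  toFun g := elt g 0 0
  map_add' _ _ := by ext <;> simp [elt]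
  map_smul' _ _ := by ext <;> simp [elt]

/-- The inclusion of `ℂ^{2n}`, which is a linear map but not a Lie algebra homomorphism. -/
def ofVec (n : ℕ) : (Fin n ⊕ Fin n → ℂ) →ₗ[ℂ] SchrodingerAlgebra n where
  toFun v := elt 0 v 0
  map_add' _ _ := by ext <;> simp [elt]
  map_smul' _ _ := by ext <;> simp [elt]

/-- The central element `z`. -/
def centralElt (n : ℕ) : SchrodingerAlgebra n := elt 0 0 1

@[simp] lemma leviPart_elt (g : Levi n) (v : Fin n ⊕ Fin n → ℂ) (t : ℂ) :
    leviPart n (elt g v t) = g := rfl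
@[simp] lemma vecPart_elt (g : Levi n) (v : Fin n ⊕ Fin n → ℂ) (t : ℂ) :
    vecPart n (elt g v t) = v := rfl
@[simp] lemma centralPart_elt (g : Levi n) (v : Fin n ⊕ Fin n → ℂ) (t : ℂ) :
    centralPart n (elt g v t) = t := rfl
@[simp] lemma leviPart_ofLevi (g : Levi n) : leviPart n (ofLevi n g) = g := rfl
@[simp] lemma vecPart_ofLevi (g : Levi n) : vecPart n (ofLevi n g) = 0 := rfl
@[simp] lemma centralPart_ofLevi (g : Levi n) : centralPart n (ofLevi n g) = 0 := rfl
@[simp] lemma leviPart_ofVec (v : Fin n ⊕ Fin n → ℂ) : leviPart n (ofVec n v) = 0 := rfl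
@[simp] lemma vecPart_ofVec (v : Fin n ⊕ Fin n → ℂ) : vecPart n (ofVec n v) = v := rfl
@[simp] lemma centralPart_ofVec (v : Fin n ⊕ Fin n → ℂ) : centralPart n (ofVec n v) = 0 := rfl
@[simp] lemma leviPart_centralElt : leviPart n (centralElt n) = 0 := rfl
@[simp] lemma vecPart_centralElt : vecPart n (centralElt n) = 0 := rfl
@[simp] lemma centralPart_centralElt : centralPart n (centralElt n) = 1 := rfl

lemma ext_parts {x y : SchrodingerAlgebra n} (h1 : leviPart n x = leviPart n y)
    (h2 : vecPart n x = vecPart n y) (h3 : centralPart n x = centralPart n y) : x = y :=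
  SemiDirectSum.ext (Heisenberg.ext h2 h3) h1

lemma elt_eq_add (g : Levi n) (v : Fin n ⊕ Fin n → ℂ) (t : ℂ) :
    elt g v t = ofLevi n g + ofVec n v + t • centralElt n := by
  refine ext_parts ?_ ?_ ?_ <;> simp only [map_add, map_smul] <;> simp

@[simp] lemma leviPart_lie (x y : SchrodingerAlgebra n) :
    leviPart n ⁅x, y⁆ = ⁅leviPart n x, leviPart n y⁆ := rfl

@[simp] lemma vecPart_lie (x y : SchrodingerAlgebra n) : vecPart n ⁅x, y⁆ =
    (leviPart n x).toMatrix *ᵥ vecPart n y - (leviPart n y).toMatrix *ᵥ vecPart n x := by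
  change (⁅x.left, y.left⁆ + act n x.right y.left - act n y.right x.left).vec = _
  rw [Heisenberg.vec_sub, Heisenberg.vec_add, Heisenberg.vec_lie, zero_add]
  rfl

@[simp] lemma centralPart_lie (x y : SchrodingerAlgebra n) :
    centralPart n ⁅x, y⁆ = ω (vecPart n x) (vecPart n y) := by
  change (⁅x.left, y.left⁆ + act n x.right y.left - act n y.right x.left).central = _
  rw [Heisenberg.central_sub, Heisenberg.central_add]
  change _ + 0 - 0 = _
  rw [add_zero, sub_zero]
  rfl

@[simp] lemma Levi.toMatrix_zero : (0 : Levi n).toMatrix = 0 := by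
  simpa using Levi.toMatrix_smul (0 : ℂ) (0 : Levi n)

lemma Levi.lie_fst (g g' : Levi n) : ⁅g, g'⁆.1.1 = g.1.1 * g'.1.1 - g'.1.1 * g.1.1 := rfl

lemma Levi.lie_snd (g g' : Levi n) : ⁅g, g'⁆.2.1 = g.2.1 * g'.2.1 - g'.2.1 * g.2.1 := rfl

/-- The element `(a b; c -a)` of `sl_2`, inside `sl_2 ⊕ so_n`. -/
def sl2 (n : ℕ) (a b c : ℂ) : Levi n :=
  (⟨!![a, b; c, -a], by
    change Matrix.trace !![a, b; c, -a] = 0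
    simp [Matrix.trace_fin_two]⟩, 0)

lemma sl2_fst (a b c : ℂ) : (sl2 n a b c).1.1 = !![a, b; c, -a] := rfl

lemma sl2_snd (a b c : ℂ) : (sl2 n a b c).2.1 = 0 := rfl

/-- The elementary skew-symmetric matrix `E_{ij} - E_{ji}` of `so_n`, inside `sl_2 ⊕ so_n`. -/
def elemSkew (i j : Fin n) : Levi n :=
  (0, ⟨Matrix.single i j 1 - Matrix.single j i 1, by
    rw [LieAlgebra.Orthogonal.mem_so]; simp [transpose_sub, transpose_single]⟩)

lemma elemSkew_fst (i j : Fin n) : (elemSkew i j).1.1 = 0 := rfl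

lemma elemSkew_snd (i j : Fin n) :
    (elemSkew i j).2.1 = Matrix.single i j 1 - Matrix.single j i 1 := rfl

lemma elemSkew_self (i : Fin n) : elemSkew i i = 0 := by
  refine Levi.ext_entries rfl rfl rfl ?_
  rw [elemSkew_snd, sub_self]
  rfl

lemma lie_elemSkew {i j k : Fin n} (hij : i ≠ j) (hik : i ≠ k) (hkj : k ≠ j) :
    ⁅elemSkew i k, elemSkew k j⁆ = elemSkew i j := by
  have h1 : ⁅elemSkew i k, elemSkew k j⁆.1.1 = (elemSkew i j).1.1 := by
    rw [Levi.lie_fst, elemSkew_fst, elemSkew_fst, elemSkew_fst, mul_zero, sub_zero]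
  refine Levi.ext_entries (by rw [h1]) (by rw [h1]) (by rw [h1]) ?_
  rw [Levi.lie_snd, elemSkew_snd, elemSkew_snd, elemSkew_snd]
  simp [mul_sub, sub_mul, hij, hij.symm, hik, hik.symm, hkj, hkj.symm]

lemma Levi.eq_sum (g : Levi n) : g = sl2 n (g.1.1 0 0) (g.1.1 0 1) (g.1.1 1 0)
    + (2⁻¹ : ℂ) • ∑ i, ∑ j, g.2.1 i j • elemSkew i j := by
  have hfst : (∑ i, ∑ j, g.2.1 i j • elemSkew i j).1 = 0 := by
    simp only [Prod.fst_sum, Prod.smul_fst]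
    exact Finset.sum_eq_zero fun i _ => Finset.sum_eq_zero fun j _ => smul_zero _
  have hsnd : (∑ i, ∑ j, g.2.1 i j • elemSkew i j).2.1 = (2 : ℂ) • g.2.1 := by
    have h : (∑ i, ∑ j, g.2.1 i j • elemSkew i j).2.1
        = ∑ i, ∑ j, g.2.1 i j • (Matrix.single i j 1 - Matrix.single j i 1) := by
      simp only [Prod.snd_sum, Prod.smul_snd, AddSubmonoidClass.coe_finsetSum]
      rfl
    rw [h]
    ext a b
    simp only [Matrix.sum_apply, Matrix.smul_apply, Matrix.sub_apply, Matrix.single_apply,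
      smul_eq_mul, mul_sub, Finset.sum_sub_distrib, mul_ite, mul_one, mul_zero, ite_and,
      Finset.sum_ite_eq', Finset.mem_univ, if_true, Finset.sum_ite_irrel,
      Finset.sum_const_zero]
    linear_combination -g.apply_swap a b
  have h1 : (sl2 n (g.1.1 0 0) (g.1.1 0 1) (g.1.1 1 0)
      + (2⁻¹ : ℂ) • ∑ i, ∑ j, g.2.1 i j • elemSkew i j).1
      = (sl2 n (g.1.1 0 0) (g.1.1 0 1) (g.1.1 1 0)).1 := by
    rw [Prod.fst_add, Prod.smul_fst, hfst, smul_zero, add_zero]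
  refine Levi.ext_entries (by rw [h1]; rfl) (by rw [h1]; rfl) (by rw [h1]; rfl) ?_
  have h2 : (sl2 n (g.1.1 0 0) (g.1.1 0 1) (g.1.1 1 0)
      + (2⁻¹ : ℂ) • ∑ i, ∑ j, g.2.1 i j • elemSkew i j).2.1
      = 0 + (2⁻¹ : ℂ) • (∑ i, ∑ j, g.2.1 i j • elemSkew i j).2.1 := rfl
  rw [h2, hsnd, smul_smul]
  norm_num

/-- Every element of `sl_2` is a sum of commutators. -/
lemma sl2_eq_lie (a b c : ℂ) : sl2 n a b c =
    a • ⁅sl2 n 0 1 0, sl2 n 0 0 1⁆ + (b / 2) • ⁅sl2 n 1 0 0, sl2 n 0 1 0⁆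
      + (-c / 2) • ⁅sl2 n 1 0 0, sl2 n 0 0 1⁆ := by
  have h : ∀ x y z : Levi n, (a • x + (b / 2) • y + (-c / 2) • z).1.1
      = a • x.1.1 + (b / 2) • y.1.1 + (-c / 2) • z.1.1 := fun _ _ _ => rfl
  have h' : ∀ x y z : Levi n, (a • x + (b / 2) • y + (-c / 2) • z).2.1
      = a • x.2.1 + (b / 2) • y.2.1 + (-c / 2) • z.2.1 := fun _ _ _ => rfl
  refine Levi.ext_entries ?_ ?_ ?_ ?_
  · rw [h, Levi.lie_fst, Levi.lie_fst, Levi.lie_fst]; simp [sl2_fst]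
  · rw [h, Levi.lie_fst, Levi.lie_fst, Levi.lie_fst]; simp [sl2_fst]; ring
  · rw [h, Levi.lie_fst, Levi.lie_fst, Levi.lie_fst]; simp [sl2_fst]; ring
  · rw [h', Levi.lie_snd, Levi.lie_snd, Levi.lie_snd]; simp [sl2_snd]

/-- For `n ≥ 3` the Lie algebra `sl_2 ⊕ so_n` is perfect: a linear functional that vanishes on all
brackets is zero. -/
lemma Levi.eq_zero_of_lie (hn : 3 ≤ n) (γ : Levi n →ₗ[ℂ] ℂ) 
    (h : ∀ g g' : Levi n, γ ⁅g, g'⁆ = 0)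
    (g : Levi n) : γ g = 0 := by
  have hskew : ∀ i j, γ (elemSkew i j) = 0 := by
    intro i j
    by_cases hij : i = j
    · rw [hij, elemSkew_self, map_zero]
    · obtain ⟨k, hk⟩ : ∃ k, k ∉ ({i, j} : Finset (Fin n)) := by
        refine Finset.exists_mem_notMem_of_card_lt_card (s := {i, j}) (t := Finset.univ) ?_ |>.imp
          fun k hk => hk.2
        rw [Finset.card_univ, Fintype.card_fin]
        exact lt_of_le_of_lt Finset.card_le_two hn
      simp only [Finset.mem_insert, Finset.mem_singleton, not_or] at hk
      rw [← lie_elemSkew hij (Ne.symm hk.1) hk.2, h]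
  rw [Levi.eq_sum g, sl2_eq_lie]
  simp only [map_add, map_smul, map_sum, h, hskew, smul_zero, Finset.sum_const_zero, add_zero]

/-! ### Derivations of the Schrödinger algebra -/

lemma lie_centralElt (x : SchrodingerAlgebra n) : ⁅x, centralElt n⁆ = 0 := by
  refine ext_parts ?_ ?_ ?_ <;>
    simp [-SemiDirectSum.lie_eq_mk, -SemiDirectSum.zero_eq_mk]

/-- The centre of the Schrödinger algebra is `ℂ z`. -/
lemma eq_smul_centralElt_of_lie_eq_zero (hn : 0 < n) {y : SchrodingerAlgebra n}
    (h : ∀ x : SchrodingerAlgebra n, ⁅x, y⁆ = 0) : y = centralPart n y • centralElt n := by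
  have hvec : vecPart n y = 0 := by
    refine eq_of_symplecticForm_eq fun w => ?_
    have h1 := congrArg (centralPart n) (h (ofVec n w))
    rw [centralPart_lie, vecPart_ofVec, map_zero] at h1
    rw [symplecticForm_swap, map_zero, LinearMap.zero_apply, neg_eq_zero]
    exact h1
  have hlevi : leviPart n y = 0 := by
    refine Levi.toMatrix_injective hn ?_
    rw [Levi.toMatrix_zero]
    refine Matrix.ext_of_mulVec_single fun i => ?_
    have h1 := congrArg (vecPart n) (h (ofVec n (Pi.single i 1)))
    rw [vecPart_lie, vecPart_ofVec, leviPart_ofVec, Levi.toMatrix_zero, zero_mulVec, zero_sub,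
      map_zero, neg_eq_zero] at h1
    rw [zero_mulVec, h1]
  refine ext_parts ?_ ?_ ?_ <;> rw [map_smul]
  · rw [hlevi, leviPart_centralElt, smul_zero]
  · rw [hvec, vecPart_centralElt, smul_zero]
  · rw [centralPart_centralElt, smul_eq_mul, mul_one]

lemma lie_ofVec_ofVec (v w : Fin n ⊕ Fin n → ℂ) :
    ⁅ofVec n v, ofVec n w⁆ = ω v w • centralElt n := by
  refine ext_parts ?_ ?_ ?_ <;> rw [map_smul] <;>
    simp [-SemiDirectSum.lie_eq_mk, -SemiDirectSum.zero_eq_mk]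

lemma lie_ofLevi_ofVec (g : Levi n) (v : Fin n ⊕ Fin n → ℂ) :
    ⁅ofLevi n g, ofVec n v⁆ = ofVec n (g.toMatrix *ᵥ v) := by
  refine ext_parts ?_ ?_ ?_ <;>
    simp [-SemiDirectSum.lie_eq_mk, -SemiDirectSum.zero_eq_mk]

lemma lie_ofLevi_ofLevi (g g' : Levi n) :
    ⁅ofLevi n g, ofLevi n g'⁆ = ofLevi n ⁅g, g'⁆ := by
  refine ext_parts ?_ ?_ ?_ <;>
    simp [-SemiDirectSum.lie_eq_mk, -SemiDirectSum.zero_eq_mk]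

lemma apply_centralElt (hn : 0 < n)
    (D : LieDerivation ℂ (SchrodingerAlgebra n) (SchrodingerAlgebra n)) :
    D (centralElt n) = centralPart n (D (centralElt n)) • centralElt n := by
  refine eq_smul_centralElt_of_lie_eq_zero hn fun x => ?_
  have h := D.apply_lie_eq_add x (centralElt n)
  rw [lie_centralElt, lie_centralElt, map_zero, add_zero] at h
  exact h.symm

/-- A derivation maps `ℂ^{2n}` into the Heisenberg algebra: the element `h = diag(1, -1)` of `sl_2`
has eigenvalues `±1` on `ℂ^{2n}`, but only `0` and `±2` on `sl_2 ⊕ so_n`. -/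
lemma leviPart_apply_ofVec (D : LieDerivation ℂ (SchrodingerAlgebra n) (SchrodingerAlgebra n))
    (v : Fin n ⊕ Fin n → ℂ) : leviPart n (D (ofVec n v)) = 0 := by
  have key : ∀ (v : Fin n ⊕ Fin n → ℂ) (ε : ℂ), ε ^ 2 = 1 →
      (sl2 n 1 0 0).toMatrix *ᵥ v = ε • v → leviPart n (D (ofVec n v)) = 0 := by
    intro v ε hε hv
    have h := D.apply_lie_eq_add (ofLevi n (sl2 n 1 0 0)) (ofVec n v)
    rw [lie_ofLevi_ofVec, hv, map_smul, map_smul] at h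
    have hr := congrArg (leviPart n) h
    rw [map_smul, map_add, leviPart_lie, leviPart_lie, leviPart_ofVec, lie_zero, add_zero,
      leviPart_ofLevi] at hr
    set y := leviPart n (D (ofVec n v))
    have e1 : ε • y.1.1 = !![1, 0; 0, -1] * y.1.1 - y.1.1 * !![1, 0; 0, -1] :=
      congrArg (fun g : Levi n => g.1.1) hr
    have e2 : ε • y.2.1 = 0 * y.2.1 - y.2.1 * 0 := congrArg (fun g : Levi n => g.2.1) hr
    have hε0 : ε ≠ 0 := by rintro rfl; norm_num at hε
    have e00 := congrFun (congrFun e1 0) 0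
    have e01 := congrFun (congrFun e1 0) 1
    have e10 := congrFun (congrFun e1 1) 0
    simp only [Matrix.sub_apply, Matrix.smul_apply, Matrix.mul_apply, Fin.sum_univ_two,
      smul_eq_mul] at e00 e01 e10
    simp [hε0] at e00 e01 e10
    -- `ε y = ± 2 y` and `ε ^ 2 = 1` give `y = 0` for the off-diagonal entries `y`.
    refine Levi.ext_entries e00 ?_ ?_ ?_
    · change y.1.1 0 1 = 0
      linear_combination (-(ε + 2) / 3) * e01 + (y.1.1 0 1 / 3) * hε
    · change y.1.1 1 0 = 0
      linear_combination (-(ε - 2) / 3) * e10 + (y.1.1 1 0 / 3) * hε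
    · simpa [hε0] using e2
  have hsum : v = (Sum.elim (fun i => v (Sum.inl i)) 0 : Fin n ⊕ Fin n → ℂ)
      + (Sum.elim 0 (fun i => v (Sum.inr i)) : Fin n ⊕ Fin n → ℂ) := by
    ext (i | i) <;> simp
  have h1 := key (Sum.elim (fun i => v (Sum.inl i)) 0) 1 (by norm_num) (by
    ext (i | i)
    · rw [Levi.toMatrix_mulVec_inl]; simp [sl2]
    · rw [Levi.toMatrix_mulVec_inr]; simp [sl2])
  have h2 := key (Sum.elim 0 (fun i => v (Sum.inr i))) (-1) (by norm_num) (by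
    ext (i | i)
    · rw [Levi.toMatrix_mulVec_inl]; simp [sl2]
    · rw [Levi.toMatrix_mulVec_inr]; simp [sl2])
  rw [hsum, map_add, map_add, map_add, h1, h2, add_zero]

/-- The shape of a derivation of the Schrödinger algebra. That `ρ` comes from `sl_2 ⊕ so_n` is not
part of the claim: it suffices that `ρ` is an infinitesimal symplectic transformation. -/
lemma exists_form_of_lieDerivation (hn : 3 ≤ n)
    (D : LieDerivation ℂ (SchrodingerAlgebra n) (SchrodingerAlgebra n)) :
    ∃ (ρ : Matrix (Fin n ⊕ Fin n) (Fin n ⊕ Fin n) ℂ) (v₀ : Fin n ⊕ Fin n → ℂ) (c : ℂ),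
      (∀ v w, ω (ρ *ᵥ v) w = -ω v (ρ *ᵥ w)) ∧
      ∀ g v t, (leviPart n (D (elt g v t))).toMatrix = ρ * g.toMatrix - g.toMatrix * ρ ∧
        vecPart n (D (elt g v t)) = ρ *ᵥ v + c • v - g.toMatrix *ᵥ v₀ ∧
        centralPart n (D (elt g v t)) = ω v₀ v + 2 * c * t := by
  have hn0 : 0 < n := by omega
  let P : (Fin n ⊕ Fin n → ℂ) →ₗ[ℂ] (Fin n ⊕ Fin n → ℂ) :=
    vecPart n ∘ₗ D.toLinearMap ∘ₗ ofVec n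
  have hP : ∀ v, vecPart n (D (ofVec n v)) = P v := fun _ => rfl
  obtain ⟨v₀, hv₀⟩ := exists_symplecticForm_eq (centralPart n ∘ₗ D.toLinearMap ∘ₗ ofVec n)
  have hψ : ∀ v, centralPart n (D (ofVec n v)) = ω v₀ v := hv₀
  set κ := centralPart n (D (centralElt n)) with hκ
  let ρ := LinearMap.toMatrix' P - (κ / 2) • (1 : Matrix (Fin n ⊕ Fin n) (Fin n ⊕ Fin n) ℂ)
  have hρ : ∀ v, ρ *ᵥ v = P v - (κ / 2) • v := fun v => by
    simp only [ρ, sub_mulVec, LinearMap.toMatrix'_mulVec, smul_mulVec, one_mulVec]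
  have hlie : ∀ g v, D (ofVec n (g.toMatrix *ᵥ v)) =
      ⁅ofLevi n g, D (ofVec n v)⁆ + ⁅D (ofLevi n g), ofVec n v⁆ := fun g v => by
    rw [← lie_ofLevi_ofVec, D.apply_lie_eq_add]
  have hα : ∀ g v, P (g.toMatrix *ᵥ v) =
      g.toMatrix *ᵥ P v + (leviPart n (D (ofLevi n g))).toMatrix *ᵥ v := fun g v => by
    have h := congrArg (vecPart n) (hlie g v)
    rw [hP, map_add, vecPart_lie, vecPart_lie, hP, leviPart_apply_ofVec] at h
    simpa using h
  have hβ : ∀ g, vecPart n (D (ofLevi n g)) = -(g.toMatrix *ᵥ v₀) := fun g => by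
    refine eq_of_symplecticForm_eq fun w => ?_
    have h := congrArg (centralPart n) (hlie g w)
    rw [hψ, map_add, centralPart_lie, centralPart_lie, vecPart_ofLevi, map_zero,
      LinearMap.zero_apply, zero_add, vecPart_ofVec] at h
    rw [← h, map_neg, LinearMap.neg_apply, symplecticForm_toMatrix, neg_neg]
  have hγ : ∀ g, centralPart n (D (ofLevi n g)) = 0 :=
    Levi.eq_zero_of_lie hn (centralPart n ∘ₗ D.toLinearMap ∘ₗ ofLevi n) fun g g' => by
      change centralPart n (D (ofLevi n ⁅g, g'⁆)) = 0
      rw [← lie_ofLevi_ofLevi, D.apply_lie_eq_add, map_add, centralPart_lie, centralPart_lie,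
        vecPart_ofLevi, vecPart_ofLevi, map_zero, map_zero, LinearMap.zero_apply, add_zero]
  have hκP : ∀ v w, ω v w * κ = ω v (P w) + ω (P v) w := fun v w => by
    have h := congrArg (centralPart n) (D.apply_lie_eq_add (ofVec n v) (ofVec n w))
    rw [lie_ofVec_ofVec, map_smul, map_smul, map_add, centralPart_lie, centralPart_lie, hP, hP,
      vecPart_ofVec, vecPart_ofVec] at h
    exact h
  refine ⟨ρ, v₀, κ / 2, fun v w => ?_, fun g v t => ?_⟩
  · rw [hρ, hρ, map_sub, map_sub, LinearMap.sub_apply, map_smul, map_smul, LinearMap.smul_apply,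
      smul_eq_mul]
    linear_combination -hκP v w
  rw [elt_eq_add, map_add, map_add, map_smul, apply_centralElt hn0 D, ← hκ]
  simp only [map_add, map_smul, hP, hβ, hψ, hγ, leviPart_apply_ofVec, leviPart_centralElt,
    vecPart_centralElt, centralPart_centralElt, smul_zero, add_zero, smul_eq_mul]
  refine ⟨?_, ?_, by ring⟩
  · refine Matrix.ext_of_mulVec_single fun i => ?_
    rw [sub_mulVec, ← mulVec_mulVec, ← mulVec_mulVec, hρ, hρ, hα, mulVec_sub, mulVec_smul]
    abel
  · rw [hρ]
    abel

/-- The outer derivation of the Schrödinger algebra: the grading by `0` on `sl_2 ⊕ so_n`, by `1` on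
`ℂ^{2n}` and by `2` on `z`. -/
noncomputable def gradingDer (n : ℕ) :
    LieDerivation ℂ (SchrodingerAlgebra n) (SchrodingerAlgebra n) where
  toFun x := elt 0 (vecPart n x) (2 * centralPart n x)
  map_add' x y := by
    refine ext_parts ?_ ?_ ?_ <;> simp only [map_add, leviPart_elt, vecPart_elt, centralPart_elt,
      add_zero, mul_add]
  map_smul' c x := by
    refine ext_parts ?_ ?_ ?_ <;> simp only [map_smul, leviPart_elt, vecPart_elt, centralPart_elt,
      smul_zero, smul_eq_mul, RingHom.id_apply, mul_left_comm]
  leibniz' x y := by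
    refine ext_parts ?_ ?_ ?_ <;> simp only [LinearMap.coe_mk, AddHom.coe_mk, map_sub,
      leviPart_lie, vecPart_lie, centralPart_lie, leviPart_elt, vecPart_elt, centralPart_elt]
    · rw [lie_zero, lie_zero, sub_zero]
    · rw [Levi.toMatrix_zero, zero_mulVec, zero_mulVec, sub_zero, sub_zero]
    · rw [symplecticForm_swap (vecPart n y)]
      ring

lemma gradingDer_apply (x : SchrodingerAlgebra n) :
    gradingDer n x = elt 0 (vecPart n x) (2 * centralPart n x) := rfl

/-! ### Linear constraints on local derivations -/

section LocalDerivation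

variable {Δ : SchrodingerAlgebra n →ₗ[ℂ] SchrodingerAlgebra n}

/-- The element `g + G w + t z` with `t = ω (G w) w / 2`, where `G` is the matrix of `g`, is the
image of `g` under the inner automorphism `exp (ad (-w))`. For this `t` the vector `v₀` and the
scalar `c` of a derivation cancel from the identity below, which is therefore inherited by every
local derivation. -/
lemma IsLocalDerivation.symplecticForm_vecPart (hn : 3 ≤ n) (hΔ : IsLocalDerivation Δ)
    (g : Levi n) (w : Fin n ⊕ Fin n → ℂ) :
    ω (vecPart n (Δ (elt g (g.toMatrix *ᵥ w) (2⁻¹ * ω (g.toMatrix *ᵥ w) w)))) w =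
      2⁻¹ * ω ((leviPart n (Δ (elt g (g.toMatrix *ᵥ w)
        (2⁻¹ * ω (g.toMatrix *ᵥ w) w)))).toMatrix *ᵥ w) w
      + centralPart n (Δ (elt g (g.toMatrix *ᵥ w) (2⁻¹ * ω (g.toMatrix *ᵥ w) w))) := by
  obtain ⟨D, hD⟩ := hΔ (elt g (g.toMatrix *ᵥ w) (2⁻¹ * ω (g.toMatrix *ᵥ w) w))
  obtain ⟨ρ, v₀, c, hρ, hform⟩ := exists_form_of_lieDerivation hn D
  obtain ⟨h1, h2, h3⟩ := hform g (g.toMatrix *ᵥ w) (2⁻¹ * ω (g.toMatrix *ᵥ w) w)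
  rw [hD, h1, h2, h3]
  simp only [map_add, map_sub, map_smul, LinearMap.add_apply, LinearMap.sub_apply,
    LinearMap.smul_apply, smul_eq_mul, sub_mulVec, ← mulVec_mulVec]
  have h4 := symplecticForm_toMatrix g v₀ w
  have h5 := symplecticForm_toMatrix g (ρ *ᵥ w) w
  rw [hρ w, symplecticForm_swap w] at h5
  linear_combination -h4 + 2⁻¹ * h5

lemma IsLocalDerivation.leviPart_ofVec (hΔ : IsLocalDerivation Δ)
    (v : Fin n ⊕ Fin n → ℂ) : leviPart n (Δ (ofVec n v)) = 0 := by
  obtain ⟨D, hD⟩ := hΔ (ofVec n v)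
  rw [hD, leviPart_apply_ofVec]

lemma IsLocalDerivation.apply_centralElt (hn : 3 ≤ n) (hΔ : IsLocalDerivation Δ) :
    Δ (centralElt n) = centralPart n (Δ (centralElt n)) • centralElt n := by
  obtain ⟨D, hD⟩ := hΔ (centralElt n)
  rw [hD]
  exact Schrodinger.apply_centralElt (by omega) D

lemma IsLocalDerivation.centralPart_ofLevi (hn : 3 ≤ n) (hΔ : IsLocalDerivation Δ) (g : Levi n) :
    centralPart n (Δ (ofLevi n g)) = 0 := by
  obtain ⟨D, hD⟩ := hΔ (ofLevi n g)
  obtain ⟨ρ, v₀, c, -, hform⟩ := exists_form_of_lieDerivation hn D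
  rw [hD]
  refine (hform g 0 0).2.2.trans ?_
  rw [map_zero, mul_zero, add_zero]

/-- The `so_n`-component of `Δ s` vanishes for `s ∈ sl_2`: twice this component is the partial trace
over `ℂ^2` of a commutator `[ρ, s ⊗ 1]`. -/
lemma IsLocalDerivation.leviPart_sl2_snd (hn : 3 ≤ n) (hΔ : IsLocalDerivation Δ) (a b c : ℂ) :
    (leviPart n (Δ (ofLevi n (sl2 n a b c)))).2.1 = 0 := by
  obtain ⟨D, hD⟩ := hΔ (ofLevi n (sl2 n a b c))
  obtain ⟨ρ, v₀, κ, -, hform⟩ := exists_form_of_lieDerivation hn D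
  have h : (leviPart n (Δ (ofLevi n (sl2 n a b c)))).toMatrix
      = ρ * (sl2 n a b c).toMatrix - (sl2 n a b c).toMatrix * ρ := by
    rw [hD]
    exact (hform _ 0 0).1
  ext i j
  have h1 := congrFun (congrFun h (Sum.inl i)) (Sum.inl j)
  have h2 := congrFun (congrFun h (Sum.inr i)) (Sum.inr j)
  simp only [Levi.toMatrix_inl_inl, Levi.toMatrix_inr_inr, Matrix.sub_apply, Matrix.mul_apply,
    Fintype.sum_sum_type, Levi.toMatrix_inl_inr, Levi.toMatrix_inr_inl] at h1 h2
  simp [sl2_fst, sl2_snd, Matrix.one_apply] at h1 h2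
  rw [Matrix.zero_apply]
  split_ifs at h1 h2 <;> linear_combination 2⁻¹ * h1 + 2⁻¹ * h2

lemma IsLocalDerivation.leviPart_sl2_fst (hn : 3 ≤ n) (hΔ : IsLocalDerivation Δ) :
    (leviPart n (Δ (ofLevi n (sl2 n 1 0 0)))).1.1 0 0 = 0 := by
  obtain ⟨D, hD⟩ := hΔ (ofLevi n (sl2 n 1 0 0))
  obtain ⟨ρ, v₀, κ, -, hform⟩ := exists_form_of_lieDerivation hn D
  have h : (leviPart n (Δ (ofLevi n (sl2 n 1 0 0)))).toMatrix
      = ρ * (sl2 n 1 0 0).toMatrix - (sl2 n 1 0 0).toMatrix * ρ := by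
    rw [hD]
    exact (hform _ 0 0).1
  let k : Fin n := ⟨0, by omega⟩
  have h1 := congrFun (congrFun h (Sum.inl k)) (Sum.inl k)
  simp only [Levi.toMatrix_inl_inl, Matrix.sub_apply, Matrix.mul_apply, Levi.apply_self,
    Fintype.sum_sum_type, Levi.toMatrix_inl_inr, Levi.toMatrix_inr_inl] at h1
  simpa [sl2_fst, sl2_snd, Matrix.one_apply] using h1

end LocalDerivation

/-! ### Local derivations are derivations -/

/-- If `Q` satisfies `ω (Q (G w)) w = ω (A(g) w) w / 2` for all `g`, where `A` maps `sl_2` to itself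
and the image of `diag(1, -1)` has zero diagonal, then `Q` belongs to `sl_2 ⊕ so_n`. Only the
standard basis of `sl_2` is used: it determines the four blocks of `Q`. -/
lemma exists_levi_toMatrix_eq (Q : Matrix (Fin n ⊕ Fin n) (Fin n ⊕ Fin n) ℂ)
    (A : Levi n → Levi n)
    (hQ : ∀ g w, ω (Q *ᵥ (g.toMatrix *ᵥ w)) w = 2⁻¹ * ω ((A g).toMatrix *ᵥ w) w)
    (hso : ∀ a b c, (A (sl2 n a b c)).2.1 = 0) (hh : (A (sl2 n 1 0 0)).1.1 0 0 = 0) :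
    ∃ g : Levi n, g.toMatrix = Q := by
  have key : ∀ (a b c : ℂ) (i j : Fin n),
      let M := Q * (sl2 n a b c).toMatrix - (2⁻¹ : ℂ) • (A (sl2 n a b c)).toMatrix
      M (Sum.inl j) (Sum.inl i) = M (Sum.inr i) (Sum.inr j) ∧
      M (Sum.inl j) (Sum.inr i) = -M (Sum.inl i) (Sum.inr j) := fun a b c =>
    entries_of_symplecticForm_self_eq_zero fun w => by
      rw [sub_mulVec, ← mulVec_mulVec, map_sub, LinearMap.sub_apply, hQ, smul_mulVec, map_smul,
        LinearMap.smul_apply, smul_eq_mul, sub_self]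
  simp only [Matrix.sub_apply, Matrix.smul_apply, Matrix.mul_apply, Fintype.sum_sum_type,
    Levi.toMatrix_inl_inl, Levi.toMatrix_inl_inr, Levi.toMatrix_inr_inl, Levi.toMatrix_inr_inr,
    hso, smul_eq_mul, Matrix.zero_apply, add_zero] at key
  have hH := key 1 0 0
  have hE := key 0 1 0
  have hF := key 0 0 1
  rw [hh] at hH
  set e₀ := (A (sl2 n 0 1 0)).1.1 0 0
  set e₁ := (A (sl2 n 0 1 0)).1.1 0 1
  set f₀ := (A (sl2 n 0 0 1)).1.1 0 0
  simp [sl2_fst, sl2_snd, Matrix.one_apply] at hH hE hF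
  have h22 : ∀ i j, Q (Sum.inr i) (Sum.inr j) = -Q (Sum.inl j) (Sum.inl i) := fun i j => by
    rw [(hH i j).1, neg_neg]
  have h21 : ∀ i j, Q (Sum.inr i) (Sum.inl j)
      = -e₀ * (1 : Matrix (Fin n) (Fin n) ℂ) i j := fun i j => by
    have h := (hE i j).1
    rw [Matrix.one_apply]
    by_cases hij : i = j
    · simp only [hij, if_true] at h ⊢
      linear_combination -h
    · simp only [hij, Ne.symm hij, if_false] at h ⊢
      linear_combination -h
  have h11 : ∀ i j, Q (Sum.inl j) (Sum.inl i) + Q (Sum.inl i) (Sum.inl j)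
      = e₁ * (1 : Matrix (Fin n) (Fin n) ℂ) i j := fun i j => by
    have h := (hE i j).2
    rw [Matrix.one_apply]
    by_cases hij : i = j
    · simp only [hij, if_true] at h ⊢
      linear_combination h
    · simp only [hij, Ne.symm hij, if_false] at h ⊢
      linear_combination h
  have h12 : ∀ i j, Q (Sum.inl j) (Sum.inr i)
      = f₀ * (1 : Matrix (Fin n) (Fin n) ℂ) j i := fun i j => by
    have h := (hF i j).1
    rw [Matrix.one_apply]
    by_cases hij : i = j
    · simp only [hij, if_true] at h ⊢
      linear_combination h
    · simp only [hij, Ne.symm hij, if_false] at h ⊢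
      linear_combination h
  have hskew : (Matrix.of fun i j => Q (Sum.inl i) (Sum.inl j)
      - e₁ / 2 * (1 : Matrix (Fin n) (Fin n) ℂ) i j) ∈ LieAlgebra.Orthogonal.so (Fin n) ℂ := by
    rw [LieAlgebra.Orthogonal.mem_so]
    ext i j
    have h1 : (1 : Matrix (Fin n) (Fin n) ℂ) j i = (1 : Matrix (Fin n) (Fin n) ℂ) i j := by
      simp only [Matrix.one_apply, eq_comm]
    simp only [Matrix.transpose_apply, Matrix.neg_apply, Matrix.of_apply, h1]
    linear_combination h11 i j
  refine ⟨((sl2 n (e₁ / 2) f₀ (-e₀)).1, ⟨_, hskew⟩), ?_⟩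
  ext (i | i) (j | j)
  · rw [Levi.toMatrix_inl_inl]
    simp [sl2_fst]
  · rw [Levi.toMatrix_inl_inr, h12]
    simp [sl2_fst]
  · rw [Levi.toMatrix_inr_inl, h21]
    simp [sl2_fst]
  · rw [Levi.toMatrix_inr_inr, h22]
    simp [sl2_fst]
    linear_combination h11 i j

end Schrodinger

open Schrodinger Matrix in
theorem mainTheorem1 (n : ℕ) (hn : 3 ≤ n)
    (Δ : Schrodinger.SchrodingerAlgebra n →ₗ[ℂ] Schrodinger.SchrodingerAlgebra n)
    (hΔ : IsLocalDerivation Δ) :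
    ∃ D : LieDerivation ℂ (Schrodinger.SchrodingerAlgebra n) (Schrodinger.SchrodingerAlgebra n),
      ∀ x : Schrodinger.SchrodingerAlgebra n, Δ x = D x := by
  have hn0 : 0 < n := by omega
  -- The components of `Δ` on `ℂ^{2n}` and on `sl_2 ⊕ so_n`.
  let P := vecPart n ∘ₗ Δ ∘ₗ ofVec n
  let A : Levi n → Levi n := fun g => leviPart n (Δ (ofLevi n g))
  let B : Levi n → Fin n ⊕ Fin n → ℂ := fun g => vecPart n (Δ (ofLevi n g))
  have hP : ∀ v, vecPart n (Δ (ofVec n v)) = P v := fun _ => rfl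
  have hA : ∀ g, leviPart n (Δ (ofLevi n g)) = A g := fun _ => rfl
  have hB : ∀ g, vecPart n (Δ (ofLevi n g)) = B g := fun _ => rfl
  obtain ⟨v₁, hv₁⟩ := exists_symplecticForm_eq (centralPart n ∘ₗ Δ ∘ₗ ofVec n)
  have hφ : ∀ v, centralPart n (Δ (ofVec n v)) = symplecticForm n v₁ v := hv₁
  set μ := centralPart n (Δ (centralElt n)) with hμ
  have hΔelt : ∀ g v t, leviPart n (Δ (elt g v t)) = A g ∧
      vecPart n (Δ (elt g v t)) = B g + P v ∧
      centralPart n (Δ (elt g v t)) = symplecticForm n v₁ v + μ * t := fun g v t => by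
    rw [elt_eq_add, map_add, map_add, map_smul, IsLocalDerivation.apply_centralElt hn hΔ, ← hμ]
    simp only [map_add, map_smul, hP, hA, hB, hφ, IsLocalDerivation.leviPart_ofVec hΔ,
      IsLocalDerivation.centralPart_ofLevi hn hΔ, leviPart_centralElt, vecPart_centralElt,
      centralPart_centralElt, smul_zero, smul_eq_mul, add_zero, zero_add, mul_one, true_and]
    ring
  -- Subtracting the grading derivation times `μ / 2` makes the action on `z` zero.
  let Q := LinearMap.toMatrix' P - (μ / 2) • (1 : Matrix (Fin n ⊕ Fin n) (Fin n ⊕ Fin n) ℂ)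
  have hQ : ∀ v, Q *ᵥ v = P v - (μ / 2) • v := fun v => by
    simp only [Q, sub_mulVec, LinearMap.toMatrix'_mulVec, smul_mulVec, one_mulVec]
  have identity : ∀ (g : Levi n) w,
      symplecticForm n (B g) w + symplecticForm n (P (g.toMatrix *ᵥ w)) w =
        2⁻¹ * symplecticForm n ((A g).toMatrix *ᵥ w) w
        + symplecticForm n v₁ (g.toMatrix *ᵥ w)
        + μ * (2⁻¹ * symplecticForm n (g.toMatrix *ᵥ w) w) := fun g w => by
    have h := IsLocalDerivation.symplecticForm_vecPart hn hΔ g w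
    obtain ⟨h1, h2, h3⟩ := hΔelt g (g.toMatrix *ᵥ w)
      (2⁻¹ * symplecticForm n (g.toMatrix *ᵥ w) w)
    rw [h1, h2, h3, map_add, LinearMap.add_apply] at h
    rw [h, add_assoc]
  -- Replacing `w` by `-w` separates the parts of degree one and two in `w`.
  have identity_neg : ∀ (g : Levi n) w,
      -symplecticForm n (B g) w + symplecticForm n (P (g.toMatrix *ᵥ w)) w =
        2⁻¹ * symplecticForm n ((A g).toMatrix *ᵥ w) w
        - symplecticForm n v₁ (g.toMatrix *ᵥ w)
        + μ * (2⁻¹ * symplecticForm n (g.toMatrix *ᵥ w) w) := fun g w => by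
    have h := identity g (-w)
    simp only [mulVec_neg, map_neg, LinearMap.neg_apply, neg_neg] at h
    rw [h, sub_eq_add_neg]
  have hBg : ∀ g, B g = -(g.toMatrix *ᵥ v₁) := fun g => by
    refine eq_of_symplecticForm_eq fun w => ?_
    rw [map_neg, LinearMap.neg_apply, symplecticForm_toMatrix, neg_neg]
    linear_combination 2⁻¹ * identity g w - 2⁻¹ * identity_neg g w
  have hQg : ∀ (g : Levi n) w, symplecticForm n (Q *ᵥ (g.toMatrix *ᵥ w)) w
      = 2⁻¹ * symplecticForm n ((A g).toMatrix *ᵥ w) w := fun g w => by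
    rw [hQ, map_sub, LinearMap.sub_apply, map_smul, LinearMap.smul_apply, smul_eq_mul]
    linear_combination 2⁻¹ * identity g w + 2⁻¹ * identity_neg g w
  obtain ⟨g₁, hg₁⟩ := exists_levi_toMatrix_eq Q A hQg
    (IsLocalDerivation.leviPart_sl2_snd hn hΔ) (IsLocalDerivation.leviPart_sl2_fst hn hΔ)
  have hAg : ∀ g, A g = ⁅g₁, g⁆ := fun g => by
    refine Levi.eq_of_symplecticForm_self_eq hn0 fun w => ?_
    have h1 := hQg g w
    have h2 := symplecticForm_toMatrix g (g₁.toMatrix *ᵥ w) w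
    rw [symplecticForm_toMatrix g₁ w, symplecticForm_swap w] at h2
    rw [← hg₁] at h1
    rw [Levi.toMatrix_lie, sub_mulVec, map_sub, LinearMap.sub_apply, ← mulVec_mulVec,
      ← mulVec_mulVec]
    linear_combination h2 - 2 * h1
  refine ⟨LieDerivation.ad ℂ _ (elt g₁ v₁ 0) + (μ / 2) • gradingDer n, fun x => ?_⟩
  obtain ⟨⟨v, t⟩, g⟩ := x
  change Δ (elt g v t) = _
  obtain ⟨h1, h2, h3⟩ := hΔelt g v t
  have had : LieDerivation.ad ℂ (SchrodingerAlgebra n) (elt g₁ v₁ 0) (elt g v t)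
      = ⁅elt g₁ v₁ 0, elt g v t⁆ := by
    rw [LieDerivation.ad_apply_apply]
  change _ = LieDerivation.ad ℂ (SchrodingerAlgebra n) (elt g₁ v₁ 0) (elt g v t)
    + (μ / 2) • gradingDer n (elt g v t)
  rw [had, gradingDer_apply]
  refine ext_parts ?_ ?_ ?_
  · rw [h1, map_add, map_smul, leviPart_lie, hAg]
    simp only [leviPart_elt, smul_zero, add_zero]
  · rw [h2, hBg, map_add, map_smul, vecPart_lie]
    change _ = g₁.toMatrix *ᵥ v - g.toMatrix *ᵥ v₁ + (μ / 2) • v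
    rw [hg₁, hQ]
    abel
  · rw [h3, map_add, map_smul, centralPart_lie]
    change _ = symplecticForm n v₁ v + (μ / 2) * (2 * t)
    ring
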